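/- For a finite simple graph $G$ let $d(v)$ denote the degree of the vertex $v$. Let $f\in\mathbb R[x,y]$ be a polynomial that is monotone on pairs of positive integers, that is, $f(x,y)\le f(x',y')$ for all positive integers $x\le x'$ and $y\le y'$. Let $Q$ be the index $$Q(G)=\sum_{uv\in E(G)}\bigl(f(d(u),d(v))+f(d(v),d(u))\bigr),$$ and suppose that $Q$ is not identically zero (equivalently, $f\neq 0$). For a finite graph $F$, a graph is $F$-free if it has no (not necessarily induced) subgraph isomorphic to $F$, and $\mathrm{ex}_Q(n,F)$ denotes the largest value of $Q(G)$ among the $F$-free graphs $G$ on $n$ vertices. Let $F$ be a finite graph with chromatic number $3$ and let $\varepsilon>0$. Then there exist $\delta>0$ and $n_0$ (depending only on $Q$, $F$ and $\varepsilon$) such that for every $n\ge n_0$ and every $F$-free graph $G$ on $n$ vertices with $Q(G)\ge(1-\delta)\,\mathrm{ex}_Q(n,F)$, the graph $G$ can be turned into a complete bipartite graph $K_{m,n-m}$ with $1\le m\le n-1$ on the same vertex set by adding and removing at most $\varepsilon n^2$ edges in total. -/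

import Mathlib

open Classical in
/-- The degree-based sum `∑_{uv ∈ E(G)} f(d(u), d(v))`, where every edge `uv` contributes both
`f(d(u), d(v))` and `f(d(v), d(u))`: the sum runs over all ordered pairs of adjacent vertices. -/
noncomputable def degreeSum {V : Type*} [Fintype V] (f : ℕ → ℕ → ℝ) (G : SimpleGraph V) : ℝ :=
  ∑ u : V, ∑ v : V, if G.Adj u v then f (G.degree u) (G.degree v) else 0

/-- A graph parameter: a real number attached to every graph on `n` labelled vertices. -/
abbrev GraphParameter : Type := (n : ℕ) → SimpleGraph (Fin n) → ℝ

/-- Monotonicity of a function of two degrees. Only the values at positive integers matter, as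
the end vertices of an edge have positive degrees. -/
def MonotoneInDegrees (f : ℕ → ℕ → ℝ) : Prop :=
  ∀ x x' y y' : ℕ, 1 ≤ x → 1 ≤ y → x ≤ x' → y ≤ y' → f x y ≤ f x' y'

/-- The function on pairs of degrees given by a real polynomial in two variables. -/
noncomputable def polyFun (p : MvPolynomial (Fin 2) ℝ) (x y : ℕ) : ℝ :=
  MvPolynomial.eval ![(x : ℝ), (y : ℝ)] p

/-- `Q` is a monotone increasing topological index that is given by a polynomial. -/
def IsMonotonePolynomialIndex (Q : GraphParameter) : Prop :=
  ∃ p : MvPolynomial (Fin 2) ℝ, MonotoneInDegrees (polyFun p) ∧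
    ∀ (n : ℕ) (G : SimpleGraph (Fin n)), Q n G = degreeSum (polyFun p) G

/-- `ex_Q(n, F)`: the largest value of `Q` among the `F`-free graphs on `n` vertices (`F`-free:
no subgraph, induced or not, is isomorphic to `F`). The set of values is finite. -/
noncomputable def exIndex {W : Type*} (Q : GraphParameter) (n : ℕ) (F : SimpleGraph W) : ℝ :=
  sSup {q : ℝ | ∃ G : SimpleGraph (Fin n), F.Free G ∧ Q n G = q}

/-- The supremum in `exIndex` is attained whenever an `F`-free graph on `n` vertices exists. -/
theorem isGreatest_exIndex {W : Type*} (Q : GraphParameter) (n : ℕ) (F : SimpleGraph W)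
    (h : ∃ G : SimpleGraph (Fin n), F.Free G) :
    IsGreatest {q : ℝ | ∃ G : SimpleGraph (Fin n), F.Free G ∧ Q n G = q} (exIndex Q n F) := by
  have hfin : {q : ℝ | ∃ G : SimpleGraph (Fin n), F.Free G ∧ Q n G = q}.Finite :=
    (Set.finite_range (Q n)).subset (by rintro q ⟨G, -, rfl⟩; exact ⟨G, rfl⟩)
  obtain ⟨G, hG⟩ := h
  have hne : {q : ℝ | ∃ G : SimpleGraph (Fin n), F.Free G ∧ Q n G = q}.Nonempty :=
    ⟨Q n G, G, hG, rfl⟩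
  exact ⟨hne.csSup_mem hfin, fun q hq => le_csSup hfin.bddAbove hq⟩

/-- `K` is a complete bipartite graph `K_{a,b}` with two non-empty parts. -/
def IsCompleteBipartiteGraph {V : Type*} (K : SimpleGraph V) : Prop :=
  ∃ A : Set V, A.Nonempty ∧ Aᶜ.Nonempty ∧
    ∀ u v : V, K.Adj u v ↔ (u ∈ A ∧ v ∉ A) ∨ (u ∉ A ∧ v ∈ A)

/-- The number of edges that have to be added or removed to turn `G` into `K`. -/
noncomputable def editDistance {V : Type*} (G K : SimpleGraph V) : ℕ :=
  (symmDiff G.edgeSet K.edgeSet).ncard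

/-! The heart is the triangle-free case. Adjacent vertices of a triangle-free graph have disjoint
neighbourhoods, so monotonicity bounds the weight of an edge at `v` by its weight in the complete
bipartite graph with parts `d(v)` and `n - d(v)`. If `M` bounds the index of every such graph,
summation gives `2 Q(G) ≤ M ∑ 1 / (n - d(v))`. Splitting this sum at the neighbourhood `A` of a
vertex of maximum degree shows that it is at most 2, and a near-equality forces almost all pairs
between `A` and its complement to be edges (`exists_editDistance_le_of_cliqueFree_three`).

The general case reduces to this one. As `F` is 3-colourable, an `F`-free graph has `o(n^3)`
triangles, and triangle removal destroys them by deleting `o(n^2)` edges. For a polynomial of degree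
`D` this costs `o(n^(D+2))` in the index (`degreeSum_sub_degreeSum_le`), while balanced complete
bipartite graphs, which are `F`-free, show that the extremal value has order at least `n^(D+2)`
(`exists_pow_le_exIndex`). Monotonicity makes the leading form positive on the diagonal; only
negative constants escape, and there near-extremal graphs have no edges. -/

/-! ### Supersaturation of triangles -/

open Finset in
/-- A dense bipartite relation has a `t`-set on one side whose common neighbourhood on the other
side has positive density. -/
theorem exists_common_neighborhood (c : ℝ) (hc : 0 < c) (t : ℕ) :
    ∃ c' : ℝ, 0 < c' ∧ ∃ N : ℕ, ∀ {α : Type} {β : Type} (X : Finset α) (Y : Finset β)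
      (R : α → β → Prop) [∀ x y, Decidable (R x y)], N ≤ #X →
      c * #X * #Y ≤ ∑ x ∈ X, (#{y ∈ Y | R x y} : ℝ) →
      ∃ S ⊆ X, #S = t ∧ c' * #Y ≤ (#{y ∈ Y | ∀ x ∈ S, R x y} : ℝ) := by
  classical
  -- A sample of `K` dense elements of `X` has average degree at least `cK/2` from `Y`; elements of
  -- `Y` with fewer than `t` neighbours account for at most `t ≤ cK/4` of it.
  obtain ⟨K, hK⟩ := exists_nat_gt (4 * t / c + t)
  have hq : 0 ≤ 4 * (t : ℝ) / c := by positivity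
  have htK : t ≤ K := by
    have : (t : ℝ) < K := by linarith
    exact_mod_cast this.le
  have hK0 : (0 : ℝ) < K := by
    have : (0 : ℝ) ≤ t := by positivity
    linarith
  have hK4 : 4 * (t : ℝ) ≤ c * K := by
    have : 4 * (t : ℝ) / c ≤ K := by
      have : (0 : ℝ) ≤ t := by positivity
      linarith
    rw [div_le_iff₀ hc] at this
    linarith
  obtain ⟨N, hN⟩ := exists_nat_gt (2 * K / c + t)
  -- A proportion `c/4` of `Y` sees at least `t` of the `K` sampled elements; pigeonhole over at
  -- most `2 ^ K` subsets of size `t` loses the other factor.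
  refine ⟨c / 4 / 2 ^ K, by positivity, N, ?_⟩
  intro α β X Y R _ hX hR
  have hXN : (N : ℝ) ≤ #X := by exact_mod_cast hX
  rcases Y.eq_empty_or_nonempty with rfl | hY
  · have : t ≤ #X := by
      have h2 : 0 ≤ 2 * (K : ℝ) / c := by positivity
      have : (t : ℝ) ≤ #X := by linarith
      exact_mod_cast this
    obtain ⟨S, hS, hSt⟩ := exists_subset_card_eq this
    exact ⟨S, hS, hSt, by simp⟩
  have hY0 : (0 : ℝ) < #Y := by exact_mod_cast hY.card_pos
  set H := {x ∈ X | c / 2 * #Y ≤ (#{y ∈ Y | R x y} : ℝ)} with hH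
  have hHK : K ≤ #H := by
    have h1 : ∑ x ∈ X, (#{y ∈ Y | R x y} : ℝ) ≤ #H * #Y + #X * (c / 2 * #Y) := by
      rw [← sum_filter_add_sum_filter_not X (fun x => c / 2 * #Y ≤ (#{y ∈ Y | R x y} : ℝ))]
      refine add_le_add ?_ ?_
      · refine (sum_le_card_nsmul _ _ (#Y : ℝ) ?_).trans (by rw [nsmul_eq_mul])
        intro x _
        exact_mod_cast card_filter_le _ _
      · refine (sum_le_card_nsmul _ _ (c / 2 * #Y) ?_).trans ?_
        · intro x hx
          exact (not_le.1 (mem_filter.1 hx).2).le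
        · rw [nsmul_eq_mul]
          have : (#{x ∈ X | ¬ c / 2 * #Y ≤ (#{y ∈ Y | R x y} : ℝ)} : ℝ) ≤ #X := by
            exact_mod_cast card_filter_le _ _
          gcongr
    have h2 : (c / 2 * #X) * #Y ≤ #H * #Y := by linarith
    have h3 := le_of_mul_le_mul_right h2 hY0
    have h4 : 2 * (K : ℝ) / c ≤ #X := by
      have : (0 : ℝ) ≤ t := by positivity
      linarith
    rw [div_le_iff₀ hc] at h4
    have : (K : ℝ) ≤ #H := by linarith
    exact_mod_cast this
  obtain ⟨X', hX'H, hX'K⟩ := exists_subset_card_eq hHK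
  set Y' := {y ∈ Y | t ≤ #{x ∈ X' | R x y}} with hY'
  have hYY' : c / 4 * #Y ≤ #Y' := by
    have h1 : K * (c / 2 * #Y) ≤ ∑ x ∈ X', (#{y ∈ Y | R x y} : ℝ) := by
      rw [← hX'K, ← nsmul_eq_mul]
      exact card_nsmul_le_sum _ _ _ fun x hx => (mem_filter.1 (hX'H hx)).2
    have h2 : ∑ x ∈ X', (#{y ∈ Y | R x y} : ℝ) = ∑ y ∈ Y, (#{x ∈ X' | R x y} : ℝ) := by
      exact_mod_cast sum_card_bipartiteAbove_eq_sum_card_bipartiteBelow R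
    have h3 : ∑ y ∈ Y, (#{x ∈ X' | R x y} : ℝ) ≤ #Y' * K + #Y * t := by
      rw [← sum_filter_add_sum_filter_not Y (fun y => t ≤ #{x ∈ X' | R x y})]
      refine add_le_add ?_ ?_
      · refine (sum_le_card_nsmul _ _ (K : ℝ) ?_).trans (by rw [nsmul_eq_mul])
        intro y _
        rw [← hX'K]
        exact_mod_cast card_filter_le _ _
      · refine (sum_le_card_nsmul _ _ (t : ℝ) ?_).trans ?_
        · intro y hy
          exact_mod_cast (not_le.1 (mem_filter.1 hy).2).le
        · rw [nsmul_eq_mul]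
          have : (#{y ∈ Y | ¬ t ≤ #{x ∈ X' | R x y}} : ℝ) ≤ #Y := by
            exact_mod_cast card_filter_le _ _
          gcongr
    have h4 : (#Y : ℝ) * t ≤ #Y * (c * K / 4) := by
      gcongr
      linarith
    have h5 : (c / 4 * #Y) * K ≤ #Y' * K := by linarith
    exact le_of_mul_le_mul_right h5 hK0
  have hch : ∀ y, ∃ S : Finset α, y ∈ Y' → S ⊆ X' ∧ #S = t ∧ ∀ x ∈ S, R x y := by
    intro y
    by_cases hy : y ∈ Y'
    · obtain ⟨S, hS, hSt⟩ := exists_subset_card_eq (mem_filter.1 hy).2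
      exact ⟨S, fun _ => ⟨hS.trans (filter_subset _ _), hSt, fun x hx => (mem_filter.1 (hS hx)).2⟩⟩
    · exact ⟨∅, fun h => absurd h hy⟩
  choose σ hσ using hch
  have hmaps : ∀ y ∈ Y', σ y ∈ powersetCard t X' := fun y hy =>
    mem_powersetCard.2 ⟨(hσ y hy).1, (hσ y hy).2.1⟩
  have hne : (powersetCard t X').Nonempty := powersetCard_nonempty.2 (by omega)
  have hcard : (#(powersetCard t X') : ℝ) ≤ 2 ^ K := by
    rw [card_powersetCard, hX'K]
    exact_mod_cast Nat.choose_le_two_pow K t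
  obtain ⟨S, hS, hSY⟩ := exists_le_card_fiber_of_nsmul_le_card_of_maps_to hmaps hne
    (b := c / 4 / 2 ^ K * #Y) (by
      rw [nsmul_eq_mul]
      calc (#(powersetCard t X') : ℝ) * (c / 4 / 2 ^ K * #Y)
          ≤ 2 ^ K * (c / 4 / 2 ^ K * #Y) := by gcongr
        _ = c / 4 * #Y := by field_simp
        _ ≤ _ := hYY')
  rw [mem_powersetCard] at hS
  refine ⟨S, hS.1.trans (hX'H.trans (filter_subset _ _)), hS.2, hSY.trans ?_⟩
  norm_cast
  refine card_le_card fun y hy => ?_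
  rw [mem_filter] at hy
  refine mem_filter.2 ⟨(mem_filter.1 hy.1).1, ?_⟩
  rw [← hy.2]
  exact (hσ y hy.1).2.2

/-- A `k`-colourable graph embeds in any graph that has `k` completely joined copies of its vertex
set. -/
theorem isContained_of_colorable {W V : Type*} {k : ℕ} {F : SimpleGraph W} {G : SimpleGraph V}
    (hF : F.Colorable k) (φ : Fin k → W ↪ V)
    (hφ : ∀ i j, i ≠ j → ∀ w w', G.Adj (φ i w) (φ j w')) : F.IsContained G := by
  obtain ⟨C⟩ := hF
  refine ⟨⟨⟨fun w => φ (C w) w, fun {a b} hab => hφ _ _ (C.valid hab) _ _⟩, ?_⟩⟩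
  intro a b hab
  change φ (C a) a = φ (C b) b at hab
  by_cases h : C a = C b
  · rw [h] at hab
    exact (φ (C b)).injective hab
  · exact absurd hab (hφ _ _ h a b).ne

open Finset in
/-- Supersaturation: a `3`-colourable graph `F` is contained in every large graph with a positive
density of triangles. -/
theorem card_cliqueFinset_three_lt_of_free {W : Type*} [Finite W] {F : SimpleGraph W}
    (hF : F.Colorable 3) (η : ℝ) (hη : 0 < η) :
    ∃ N : ℕ, ∀ n, N ≤ n → ∀ (G : SimpleGraph (Fin n)) [DecidableRel G.Adj], F.Free G →
      (#(G.cliqueFinset 3) : ℝ) < η * (n : ℝ) ^ 3 := by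
  classical
  cases nonempty_fintype W
  set t := Fintype.card W + 1 with ht
  obtain ⟨c₁, hc₁, N₁, h₁⟩ := exists_common_neighborhood η hη t
  obtain ⟨c₂, hc₂, N₂, h₂⟩ := exists_common_neighborhood (c₁ * η) (by positivity) t
  obtain ⟨N₃, hN₃⟩ := exists_nat_gt (t / c₂)
  refine ⟨max (max N₁ N₂) (max N₃ 1), fun n hn G _ hfree => ?_⟩
  simp only [max_le_iff] at hn
  obtain ⟨⟨hn₁, hn₂⟩, hn₃, hn0⟩ := hn
  have hn0' : (0 : ℝ) < n := by exact_mod_cast hn0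
  by_contra! htri
  apply hfree
  set Y : Finset (Fin n × Fin n) := {p | G.Adj p.1 p.2} with hY
  have hsum : (#(G.cliqueFinset 3) : ℝ) ≤
      ∑ x : Fin n, (#{p ∈ Y | G.Adj x p.1 ∧ G.Adj x p.2} : ℝ) := by
    rw [← Nat.cast_sum, ← card_sigma]
    norm_cast
    refine card_le_card_of_surjOn (fun q => {q.1, q.2.1, q.2.2}) ?_
    intro s hs
    have hs' : s ∈ G.cliqueFinset 3 := hs
    rw [SimpleGraph.mem_cliqueFinset_iff, SimpleGraph.is3Clique_iff] at hs'
    obtain ⟨a, b, c, hab, hac, hbc, rfl⟩ := hs'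
    exact ⟨⟨a, (b, c)⟩, by simp [hY, hab, hac, hbc], rfl⟩
  have hYn : (#Y : ℝ) ≤ n ^ 2 := by
    have := card_le_univ Y
    rw [Fintype.card_prod, Fintype.card_fin] at this
    rw [sq]
    exact_mod_cast this
  -- The lemma yields a proportion of `Y`, so `Y` itself must have quadratic size for the second
  -- application.
  have hYl : η * n ^ 2 ≤ #Y := by
    have : ∑ x : Fin n, (#{p ∈ Y | G.Adj x p.1 ∧ G.Adj x p.2} : ℝ) ≤ n * #Y := by
      refine (sum_le_card_nsmul _ _ (#Y : ℝ) fun x _ => ?_).trans (by simp)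
      exact_mod_cast card_filter_le _ _
    have h' : (η * n ^ 2) * n ≤ #Y * n := by nlinarith
    exact le_of_mul_le_mul_right h' hn0'
  -- Vertices against ordered edges give `S`; then the edges in the common neighbourhood of `S`,
  -- viewed as a dense bipartite relation, give `T` and `Z`.
  obtain ⟨S, -, hSt, hS⟩ := h₁ univ Y (fun x p => G.Adj x p.1 ∧ G.Adj x p.2) (by simpa using hn₁)
    (by
      refine le_trans ?_ (htri.trans hsum)
      simp only [card_univ, Fintype.card_fin]
      calc η * n * #Y ≤ η * n * n ^ 2 := by gcongr
        _ = _ := by ring)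
  obtain ⟨T, -, hTt, hT⟩ := h₂ (univ : Finset (Fin n)) (univ : Finset (Fin n))
    (fun u v => G.Adj u v ∧ ∀ s ∈ S, G.Adj s u ∧ G.Adj s v) (by simpa using hn₂)
    (by
      simp only [card_univ, Fintype.card_fin]
      calc c₁ * η * n * n = c₁ * (η * n ^ 2) := by ring
        _ ≤ c₁ * #Y := by gcongr
        _ ≤ _ := hS
        _ ≤ _ := by
          rw [← Nat.cast_sum, ← card_sigma]
          norm_cast
          refine card_le_card_of_injOn (fun p => ⟨p.1, p.2⟩) ?_ ?_
          · rintro ⟨u, v⟩ hp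
            simp [hY] at hp
            simpa using hp
          · rintro ⟨u, v⟩ _ ⟨u', v'⟩ _ h
            simpa using h)
  set Z := {y ∈ (univ : Finset (Fin n)) | ∀ x ∈ T, G.Adj x y ∧ ∀ s ∈ S, G.Adj s x ∧ G.Adj s y}
    with hZ
  have hZt : t ≤ #Z := by
    have h3 : (N₃ : ℝ) ≤ n := by exact_mod_cast hn₃
    have h4 : (t : ℝ) / c₂ ≤ n := by linarith
    rw [div_le_iff₀ hc₂] at h4
    have h5 : (t : ℝ) ≤ #Z := by
      calc (t : ℝ) ≤ c₂ * #(univ : Finset (Fin n)) := by simpa [mul_comm] using h4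
        _ ≤ _ := hT
        _ = #Z := by rw [hZ]; congr
    exact_mod_cast h5
  have emb : ∀ A : Finset (Fin n), t ≤ #A → ∃ φ : W ↪ Fin n, ∀ w, φ w ∈ A := by
    intro A hA
    have : Nonempty (W ↪ A) := Function.Embedding.nonempty_of_card_le (by
      rw [Fintype.card_coe]; omega)
    obtain ⟨φ⟩ := this
    exact ⟨φ.trans (Function.Embedding.subtype _), fun w => (φ w).2⟩
  obtain ⟨a, ha⟩ := emb S hSt.ge
  obtain ⟨b, hb⟩ := emb T hTt.ge
  obtain ⟨z, hz⟩ := emb Z hZt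
  have hZ' : ∀ w w' w'', G.Adj (b w) (z w') ∧ G.Adj (a w'') (b w) ∧ G.Adj (a w'') (z w') := by
    intro w w' w''
    have := (mem_filter.1 (hz w')).2 _ (hb w)
    exact ⟨this.1, this.2 _ (ha w'')⟩
  refine isContained_of_colorable hF ![a, b, z] ?_
  intro i j hij w w'
  fin_cases i <;> fin_cases j <;> first | exact absurd rfl hij | skip
  · exact (hZ' w' w w).2.1
  · exact (hZ' w w' w).2.2
  · exact (hZ' w w w').2.1.symm
  · exact (hZ' w w' w).1
  · exact (hZ' w w w').2.2.symm
  · exact (hZ' w' w w').1.symm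

/-! ### Stability for triangle-free graphs -/

open Classical Finset in
theorem sum_sum_ite_adj {V : Type*} [Fintype V] (G : SimpleGraph V) (g : V → ℝ) :
    ∑ u : V, ∑ v : V, (if G.Adj u v then g u else 0) = ∑ u : V, G.degree u * g u := by
  refine sum_congr rfl fun u _ => ?_
  rw [← sum_filter, sum_const, nsmul_eq_mul, ← G.card_neighborFinset_eq_degree,
    G.neighborFinset_eq_filter]

-- Symmetrising makes each term comparable with `f a b + f b a`, the quantity in the index of a
-- complete bipartite graph.
open Classical Finset in
theorem two_mul_degreeSum {V : Type*} [Fintype V] (f : ℕ → ℕ → ℝ) (G : SimpleGraph V) :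
    2 * degreeSum f G = ∑ u : V, ∑ v : V, if G.Adj u v then
      f (G.degree u) (G.degree v) + f (G.degree v) (G.degree u) else 0 := by
  have h : degreeSum f G =
      ∑ u : V, ∑ v : V, if G.Adj u v then f (G.degree v) (G.degree u) else 0 := by
    rw [degreeSum, sum_comm]
    simp only [G.adj_comm]
  rw [two_mul]
  nth_rewrite 2 [h]
  rw [degreeSum, ← sum_add_distrib]
  refine sum_congr rfl fun u _ => ?_
  rw [← sum_add_distrib]
  refine sum_congr rfl fun v _ => ?_
  split_ifs <;> simp

open Finset in
theorem degree_add_degree_le_of_cliqueFree_three {V : Type*} [Fintype V] [DecidableEq V]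
    {G : SimpleGraph V} [DecidableRel G.Adj] (hG : G.CliqueFree 3) {u v : V} (h : G.Adj u v) :
    G.degree u + G.degree v ≤ Fintype.card V := by
  rw [← G.card_neighborFinset_eq_degree, ← G.card_neighborFinset_eq_degree,
    ← card_union_of_disjoint]
  · exact card_le_univ _
  · rw [disjoint_left]
    intro w hu hv
    rw [SimpleGraph.mem_neighborFinset] at hu hv
    exact hG {u, v, w} (SimpleGraph.is3Clique_triple_iff.2 ⟨h, hu, hv⟩)

-- By monotonicity `d(v)` may be raised to `n - d(u)`, so each neighbour of `u` contributes at most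
-- `M / (d(u) (n - d(u)))`. Summing over the `d(u)` neighbours cancels `d(u)`.
open Classical Finset in
theorem degreeSum_le_of_cliqueFree_three {V : Type*} [Fintype V] {f : ℕ → ℕ → ℝ}
    (hf : MonotoneInDegrees f) {M : ℝ} (hM0 : 0 ≤ M)
    (hM : ∀ a b : ℕ, 1 ≤ a → 1 ≤ b → a + b = Fintype.card V → a * b * (f a b + f b a) ≤ M)
    {G : SimpleGraph V} (hG : G.CliqueFree 3) :
    2 * degreeSum f G ≤ M * ∑ v : V, 1 / ((Fintype.card V : ℝ) - G.degree v) := by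
  rw [two_mul_degreeSum]
  set n := Fintype.card V
  calc _ ≤ ∑ u : V, ∑ v : V, (if G.Adj u v then M / (G.degree u * (n - G.degree u)) else 0) := by
        refine sum_le_sum fun u _ => sum_le_sum fun v _ => ?_
        split_ifs with huv
        · have hu : 1 ≤ G.degree u := (G.degree_pos_iff_exists_adj u).2 ⟨v, huv⟩
          have hv : 1 ≤ G.degree v := (G.degree_pos_iff_exists_adj v).2 ⟨u, huv.symm⟩
          have huvn : G.degree u + G.degree v ≤ n := degree_add_degree_le_of_cliqueFree_three hG huv
          obtain ⟨b, hb⟩ : ∃ b, G.degree u + b = n := ⟨n - G.degree u, by omega⟩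
          have hb1 : 1 ≤ b := by omega
          have hbv : G.degree v ≤ b := by omega
          have hbr : (n : ℝ) - G.degree u = b := by rw [← hb]; push_cast; ring
          rw [hbr, le_div_iff₀ (by positivity)]
          have h1 := hf _ _ _ _ hu hv le_rfl hbv
          have h2 := hf _ _ _ _ hv hu hbv le_rfl
          calc _ ≤ (f (G.degree u) b + f b (G.degree u)) * (G.degree u * b) := by gcongr
            _ ≤ M := by
              rw [mul_comm]
              exact hM _ _ hu hb1 hb
        · exact le_rfl
    _ = ∑ u : V, G.degree u * (M / (G.degree u * (n - G.degree u))) :=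
        sum_sum_ite_adj G fun u => M / (G.degree u * (n - G.degree u))
    _ ≤ _ := by
        rw [mul_sum]
        refine sum_le_sum fun u _ => ?_
        have hd : (0 : ℝ) < n - G.degree u := by
          rw [sub_pos]
          exact_mod_cast G.degree_lt_card_verts u
        rcases Nat.eq_zero_or_pos (G.degree u) with h0 | h0
        · rw [h0]
          simp only [Nat.cast_zero, zero_mul, sub_zero]
          positivity
        · have : (0 : ℝ) < G.degree u := by exact_mod_cast h0
          apply le_of_eq
          field_simp

/-- The complete bipartite graph between a set and its complement. -/
def bipartiteOf {V : Type*} (A : Set V) : SimpleGraph V where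
  Adj u v := (u ∈ A ∧ v ∉ A) ∨ (u ∉ A ∧ v ∈ A)
  symm := ⟨fun u v h => by tauto⟩
  loopless := ⟨fun u h => by tauto⟩

open Classical Finset in
/-- If `A` is an independent set of at least as many vertices as any degree, then the distance to
the complete bipartite graph between `A` and its complement is controlled by the degrees in `A`. -/
theorem editDistance_bipartiteOf_le {V : Type*} [Fintype V] {G : SimpleGraph V} {A : Finset V}
    (hA : ∀ u ∈ A, ∀ v ∈ A, ¬ G.Adj u v) (hdeg : ∀ v, G.degree v ≤ #A) :
    (editDistance G (bipartiteOf (A : Set V)) : ℝ) ≤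
      2 * ∑ v ∈ A, ((Fintype.card V : ℝ) - #A - G.degree v) := by
  set S := ∑ v ∈ A, ((Fintype.card V : ℝ) - #A - G.degree v) with hS
  have hcompl : (#Aᶜ : ℝ) = Fintype.card V - #A := by
    rw [card_compl, Nat.cast_sub (card_le_univ A)]
  set X := (A ×ˢ Aᶜ).filter fun p => ¬ G.Adj p.1 p.2 with hX
  set Y := (Aᶜ ×ˢ Aᶜ).filter fun p => G.Adj p.1 p.2 with hY
  have hdegA : ∀ v ∈ A, G.degree v = #{w ∈ Aᶜ | G.Adj v w} := by
    intro v hv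
    rw [← G.card_neighborFinset_eq_degree, G.neighborFinset_eq_filter]
    congr 1
    ext w
    simp only [mem_filter, mem_univ, true_and, mem_compl]
    exact ⟨fun h => ⟨fun hw => hA v hv w hw h, h⟩, fun h => h.2⟩
  have hXS : (#X : ℝ) = S := by
    rw [hX, card_filter, sum_product, hS]
    push_cast
    refine sum_congr rfl fun v hv => ?_
    have h := card_filter_add_card_filter_not (s := Aᶜ) (fun w => G.Adj v w)
    rw [← hdegA v hv] at h
    rw [← hcompl, ← h, card_filter]
    push_cast
    ring
  -- Degrees in `Aᶜ` sum to at most `#A * #Aᶜ`, and the edges to `A` already use `#A * #Aᶜ - S` of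
  -- this.
  have hYS : (#Y : ℝ) ≤ S := by
    have h1 : (#Y : ℝ) = ∑ v ∈ Aᶜ, (#{w ∈ Aᶜ | G.Adj v w} : ℝ) := by
      rw [hY, card_filter, sum_product]
      push_cast
      exact sum_congr rfl fun v _ => by rw [card_filter]; push_cast; rfl
    have h2 : ∑ v ∈ Aᶜ, (#{w ∈ Aᶜ | G.Adj v w} : ℝ) + ∑ v ∈ Aᶜ, (#{w ∈ A | G.Adj v w} : ℝ)
        = ∑ v ∈ Aᶜ, (G.degree v : ℝ) := by
      rw [← sum_add_distrib]
      refine sum_congr rfl fun v _ => ?_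
      rw [← G.card_neighborFinset_eq_degree, G.neighborFinset_eq_filter, add_comm]
      norm_cast
      rw [← card_union_of_disjoint (disjoint_filter_filter disjoint_compl_right), ← filter_union,
        union_compl]
    have h3 : ∑ v ∈ Aᶜ, (#{w ∈ A | G.Adj v w} : ℝ) = ∑ w ∈ A, (G.degree w : ℝ) := by
      have := sum_card_bipartiteAbove_eq_sum_card_bipartiteBelow (s := Aᶜ) (t := A) G.Adj
      simp only [bipartiteAbove, bipartiteBelow] at this
      norm_cast
      rw [this]
      refine sum_congr rfl fun w hw => ?_
      rw [hdegA w hw]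
      simp only [G.adj_comm]
    have h4 : ∑ v ∈ Aᶜ, (G.degree v : ℝ) ≤ #Aᶜ * #A := by
      refine (sum_le_card_nsmul _ _ (#A : ℝ) fun v _ => ?_).trans (by rw [nsmul_eq_mul])
      exact_mod_cast hdeg v
    have h5 : S = #A * #Aᶜ - ∑ w ∈ A, (G.degree w : ℝ) := by
      rw [hS, sum_sub_distrib, sum_const, nsmul_eq_mul, hcompl]
    linarith
  have hsub : symmDiff G.edgeSet (bipartiteOf (A : Set V)).edgeSet ⊆
      ((X ∪ Y).image fun p => s(p.1, p.2) : Finset (Sym2 V)) := by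
    intro e
    induction e with | _ u v
    intro he
    have key : ∀ a b, (a, b) ∈ X ∪ Y ∨ (b, a) ∈ X ∪ Y →
        s(a, b) ∈ (((X ∪ Y).image fun p => s(p.1, p.2) : Finset (Sym2 V)) : Set (Sym2 V)) := by
      intro a b h
      rw [mem_coe, mem_image]
      rcases h with h | h
      · exact ⟨_, h, rfl⟩
      · exact ⟨_, h, Sym2.eq_swap⟩
    apply key
    have hs := G.adj_comm u v
    have hA' := hA u
    simp only [Set.mem_symmDiff, SimpleGraph.mem_edgeSet, bipartiteOf, mem_coe] at he
    simp only [hX, hY, mem_union, mem_filter, mem_product, mem_compl]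
    by_cases hu : u ∈ A <;> by_cases hv : v ∈ A <;> by_cases huv : G.Adj u v <;>
      simp_all
  have hcard : editDistance G (bipartiteOf (A : Set V)) ≤ #X + #Y := by
    refine (Set.ncard_le_ncard hsub (Finset.finite_toSet _)).trans ?_
    rw [Set.ncard_coe_finset]
    exact card_image_le.trans (card_union_le _ _)
  have : (editDistance G (bipartiteOf (A : Set V)) : ℝ) ≤ #X + #Y := by exact_mod_cast hcard
  linarith

open Classical Finset in
/-- Stability for triangle-free graphs: a triangle-free graph whose degree sum is close to the
largest one of a complete bipartite graph is close to a complete bipartite graph. -/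
theorem exists_editDistance_le_of_cliqueFree_three {V : Type*} [Fintype V] {f : ℕ → ℕ → ℝ}
    (hf : MonotoneInDegrees f) {M δ : ℝ} (hM0 : 0 < M) (hδ : δ < 1)
    (hM : ∀ a b : ℕ, 1 ≤ a → 1 ≤ b → a + b = Fintype.card V → a * b * (f a b + f b a) ≤ M)
    {G : SimpleGraph V} (hG : G.CliqueFree 3) (hQ : (1 - δ) * M ≤ degreeSum f G) :
    ∃ K : SimpleGraph V, IsCompleteBipartiteGraph K ∧
      (editDistance G K : ℝ) ≤ 4 * δ * (Fintype.card V : ℝ) ^ 2 := by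
  have hpos : 0 < degreeSum f G := lt_of_lt_of_le (mul_pos (by linarith) hM0) hQ
  have hne : Nonempty V := by
    by_contra h
    rw [not_nonempty_iff] at h
    simp [degreeSum] at hpos
  obtain ⟨u, hu⟩ := G.exists_maximal_degree_vertex
  have hmax : ∀ v, G.degree v ≤ G.degree u := fun v => hu ▸ G.degree_le_maxDegree v
  have hu0 : 0 < G.degree u := by
    by_contra! h
    have : ∀ x y, ¬ G.Adj x y := fun x y hxy => by
      have := (G.degree_pos_iff_exists_adj x).2 ⟨y, hxy⟩
      have := hmax x
      omega
    simp [degreeSum, this] at hpos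
  have hlt := fun v => G.degree_lt_card_verts v
  have hsum := degreeSum_le_of_cliqueFree_three hf hM0.le hM hG
  set n := Fintype.card V with hn
  set D := G.degree u with hD
  set A := G.neighborFinset u with hA
  have hAD : #A = D := G.card_neighborFinset_eq_degree u
  have hAc : (#Aᶜ : ℝ) = n - D := by
    rw [card_compl, hAD, Nat.cast_sub (hlt u).le]
  have hDn : (0 : ℝ) < n - D := by
    rw [sub_pos]
    exact_mod_cast hlt u
  have hD0 : (0 : ℝ) < D := by exact_mod_cast hu0
  have hn0 : (0 : ℝ) < n := by linarith
  have h2 : 2 * (1 - δ) ≤ ∑ v : V, 1 / ((n : ℝ) - G.degree v) := by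
    have : (2 * (1 - δ)) * M ≤ (∑ v : V, 1 / ((n : ℝ) - G.degree v)) * M := by linarith
    exact le_of_mul_le_mul_right this hM0
  have hB : ∑ v ∈ Aᶜ, 1 / ((n : ℝ) - G.degree v) ≤ 1 := by
    calc _ ≤ ∑ v ∈ Aᶜ, 1 / ((n : ℝ) - D) := by
          refine sum_le_sum fun v _ => ?_
          have : (G.degree v : ℝ) ≤ D := by exact_mod_cast hmax v
          gcongr
      _ = 1 := by
          rw [sum_const, nsmul_eq_mul, hAc]
          field_simp
  set S := ∑ v ∈ A, ((n : ℝ) - D - G.degree v) with hS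
  -- Convexity: `1 / (n - d)` lies below its chord over `0 ≤ d ≤ n - D`, whose slope is `1 / (D *
  -- n)`.
  have hAsum : ∑ v ∈ A, 1 / ((n : ℝ) - G.degree v) ≤ 1 - S / (D * n) := by
    calc _ ≤ ∑ v ∈ A, (1 / (D : ℝ) - ((n : ℝ) - D - G.degree v) / (D * n)) := by
          refine sum_le_sum fun v hv => ?_
          have huv : G.Adj u v := by simpa [hA] using hv
          have h3 : D + G.degree v ≤ n := degree_add_degree_le_of_cliqueFree_three hG huv
          have h3' : (D : ℝ) + G.degree v ≤ n := by exact_mod_cast h3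
          have h4 : (0 : ℝ) < n - G.degree v := by linarith
          have h5 : (0 : ℝ) ≤ G.degree v := by positivity
          have : 1 / (D : ℝ) - ((n : ℝ) - D - G.degree v) / (D * n) - 1 / (n - G.degree v)
              = (n - D - G.degree v) * G.degree v / (D * n * (n - G.degree v)) := by
            field_simp
            ring
          have h6 : (0 : ℝ) ≤ (n - D - G.degree v) * G.degree v / (D * n * (n - G.degree v)) := by
            have h7 : 0 ≤ (n : ℝ) - D - G.degree v := by linarith
            positivity
          linarith
      _ = 1 - S / (D * n) := by
          rw [sum_sub_distrib, hS, sum_div, sum_const, nsmul_eq_mul, hAD]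
          field_simp
  have hSle : S ≤ 2 * δ * n ^ 2 := by
    rw [← sum_add_sum_compl A] at h2
    have h3 : S / (D * n) ≤ 2 * δ := by linarith
    rw [div_le_iff₀ (by positivity)] at h3
    -- The sign of `δ` follows from `S ≥ 0`; it permits replacing `D * n` by `n ^ 2`.
    have hδ0 : 0 ≤ δ := by
      have hS0 : 0 ≤ S := by
        refine sum_nonneg fun v hv => ?_
        have huv : G.Adj u v := by simpa [hA] using hv
        have h3 : D + G.degree v ≤ n := degree_add_degree_le_of_cliqueFree_three hG huv
        have h3' : (D : ℝ) + G.degree v ≤ n := by exact_mod_cast h3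
        linarith
      by_contra! hneg
      have : 2 * δ * (D * n) < 0 := mul_neg_of_neg_of_pos (by linarith) (by positivity)
      linarith
    calc S ≤ 2 * δ * (D * n) := h3
      _ ≤ 2 * δ * (n * n) := by
        have : (D : ℝ) ≤ n := by linarith
        gcongr
      _ = _ := by ring
  refine ⟨bipartiteOf (A : Set V), ⟨A, ?_, ?_, fun _ _ => Iff.rfl⟩, ?_⟩
  · rw [coe_nonempty, ← card_pos, hAD]
    exact hu0
  · exact ⟨u, by simp [hA]⟩
  · have := editDistance_bipartiteOf_le (G := G) (A := A) (fun x hx y hy hxy => by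
      rw [hA, SimpleGraph.mem_neighborFinset] at hx hy
      exact hG {u, x, y} (SimpleGraph.is3Clique_triple_iff.2 ⟨hx, hy, hxy⟩))
      (fun v => hAD ▸ hmax v)
    rw [← hn, hAD, ← hS] at this
    linarith

/-! ### Effect of deleting edges -/

open Classical Finset in
theorem sum_degree_sub_of_le {V : Type*} [Fintype V] (G G' : SimpleGraph V) :
    ∑ u : V, ((G.degree u : ℝ) - G'.degree u) = 2 * (#G.edgeFinset - #G'.edgeFinset : ℝ) := by
  rw [sum_sub_distrib, ← Nat.cast_sum, ← Nat.cast_sum, G.sum_degrees_eq_twice_card_edges,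
    G'.sum_degrees_eq_twice_card_edges]
  push_cast
  ring

open Classical Finset in
/-- Deleting few edges changes the degree sum only a little, if `f` is bounded and Lipschitz. -/
theorem degreeSum_sub_degreeSum_le {V : Type*} [Fintype V] [Nonempty V] {f : ℕ → ℕ → ℝ} {B : ℝ}
    (hB : 0 ≤ B)
    (hb : ∀ x y : ℕ, 1 ≤ x → 1 ≤ y → x ≤ Fintype.card V → y ≤ Fintype.card V → f x y ≤ B)
    (hL : ∀ x y x' y' : ℕ, 1 ≤ x' → 1 ≤ y' → x' ≤ x → y' ≤ y → x ≤ Fintype.card V →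
      y ≤ Fintype.card V → Fintype.card V * (f x y - f x' y') ≤ B * ((x - x') + (y - y')))
    {G G' : SimpleGraph V} (hGG' : G' ≤ G) :
    degreeSum f G - degreeSum f G' ≤ 6 * B * (#G.edgeFinset - #G'.edgeFinset : ℝ) := by
  set n := Fintype.card V with hn
  have hn0 : (0 : ℝ) < n := by exact_mod_cast Fintype.card_pos
  have hle : ∀ u, G'.degree u ≤ G.degree u := fun u => SimpleGraph.degree_le_of_le hGG'
  have hle' : ∀ u, (G'.degree u : ℝ) ≤ G.degree u := fun u => by exact_mod_cast hle u
  have hub : ∀ u, G.degree u ≤ n := fun u => (G.degree_lt_card_verts u).le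
  have hsum := sum_degree_sub_of_le G G'
  set T := (#G.edgeFinset - #G'.edgeFinset : ℝ)
  have hind : ∀ H : SimpleGraph V, ∀ u, ∑ v, (if H.Adj u v then (1 : ℝ) else 0) = H.degree u := by
    intro H u
    rw [sum_boole, ← H.card_neighborFinset_eq_degree, H.neighborFinset_eq_filter]
  have hterm : ∀ u v, (n : ℝ) * ((if G.Adj u v then f (G.degree u) (G.degree v) else 0) -
      (if G'.Adj u v then f (G'.degree u) (G'.degree v) else 0)) ≤
      B * (n * ((if G.Adj u v then 1 else 0) - (if G'.Adj u v then 1 else 0)) +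
        ((G.degree u - G'.degree u) + (G.degree v - G'.degree v))) := by
    intro u v
    have hu := hle' u
    have hv := hle' v
    by_cases h : G.Adj u v
    · have hu1 : 1 ≤ G.degree u := (G.degree_pos_iff_exists_adj u).2 ⟨v, h⟩
      have hv1 : 1 ≤ G.degree v := (G.degree_pos_iff_exists_adj v).2 ⟨u, h.symm⟩
      by_cases h' : G'.Adj u v
      · have hu1 : 1 ≤ G'.degree u := (G'.degree_pos_iff_exists_adj u).2 ⟨v, h'⟩
        have hv1 : 1 ≤ G'.degree v := (G'.degree_pos_iff_exists_adj v).2 ⟨u, h'.symm⟩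
        simpa [h, h'] using hL _ _ _ _ hu1 hv1 (hle u) (hle v) (hub u) (hub v)
      · have h1 := hb _ _ hu1 hv1 (hub u) (hub v)
        simp only [h, h', if_true, if_false, sub_zero, mul_one]
        have h2 : 0 ≤ B * (((G.degree u : ℝ) - G'.degree u) + (G.degree v - G'.degree v)) :=
          mul_nonneg hB (by linarith)
        have h3 := mul_le_mul_of_nonneg_left h1 hn0.le
        linarith
    · have h' : ¬ G'.Adj u v := fun h' => h (hGG' h')
      simp only [h, h', if_false, sub_zero, mul_zero, zero_add]
      exact mul_nonneg hB (by linarith)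
  -- The 6 is 2 for the deleted edges as ordered pairs, plus 2 for the degree losses at each of the
  -- two ends.
  have htot : (n : ℝ) * (degreeSum f G - degreeSum f G') ≤ n * (6 * B * T) := by
    calc _ = ∑ u, ∑ v, (n : ℝ) * ((if G.Adj u v then f (G.degree u) (G.degree v) else 0) -
          (if G'.Adj u v then f (G'.degree u) (G'.degree v) else 0)) := by
          simp only [← mul_sum, sum_sub_distrib]
          rfl
      _ ≤ ∑ u, ∑ v, B * (n * ((if G.Adj u v then 1 else 0) - (if G'.Adj u v then 1 else 0)) +
          (((G.degree u : ℝ) - G'.degree u) + (G.degree v - G'.degree v))) :=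
          sum_le_sum fun u _ => sum_le_sum fun v _ => hterm u v
      _ = ∑ u, B * (n * ((G.degree u : ℝ) - G'.degree u) +
          (n * ((G.degree u : ℝ) - G'.degree u) + 2 * T)) := by
          refine sum_congr rfl fun u _ => ?_
          rw [← mul_sum, sum_add_distrib, ← mul_sum, sum_sub_distrib, hind, hind, sum_add_distrib,
            hsum, sum_const, card_univ, nsmul_eq_mul]
      _ = _ := by
          rw [← mul_sum, sum_add_distrib, sum_add_distrib, ← mul_sum, hsum, sum_const, card_univ,
            nsmul_eq_mul]
          ring
  exact le_of_mul_le_mul_left htot hn0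

open Classical Finset in
theorem editDistance_le_add {V : Type*} [Fintype V] {G G' : SimpleGraph V} (h : G' ≤ G)
    (K : SimpleGraph V) :
    (editDistance G K : ℝ) ≤ (#G.edgeFinset - #G'.edgeFinset : ℝ) + editDistance G' K := by
  have h1 : symmDiff G.edgeSet K.edgeSet ⊆
      (G.edgeSet \ G'.edgeSet) ∪ symmDiff G'.edgeSet K.edgeSet := by
    refine (symmDiff_triangle _ G'.edgeSet _).trans ?_
    refine Set.union_subset_union_left _ ?_
    rw [symmDiff_of_ge (SimpleGraph.edgeSet_mono h)]
  have h2 : (G.edgeSet \ G'.edgeSet).ncard + #G'.edgeFinset = #G.edgeFinset := by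
    rw [← SimpleGraph.coe_edgeFinset, ← SimpleGraph.coe_edgeFinset, ← coe_sdiff,
      Set.ncard_coe_finset]
    exact card_sdiff_add_card_eq_card (SimpleGraph.edgeFinset_mono h)
  have h3 : editDistance G K ≤ (G.edgeSet \ G'.edgeSet).ncard + editDistance G' K :=
    (Set.ncard_le_ncard h1 (Set.toFinite _)).trans (Set.ncard_union_le _ _)
  have h3' : (editDistance G K : ℝ) ≤ (G.edgeSet \ G'.edgeSet).ncard + editDistance G' K := by
    exact_mod_cast h3
  have h2' : ((G.edgeSet \ G'.edgeSet).ncard : ℝ) + #G'.edgeFinset = #G.edgeFinset := by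
    exact_mod_cast h2
  linarith

/-! ### Complete bipartite graphs and lower bounds for the extremal value -/

open Classical Finset in
theorem degreeSum_bipartiteOf {V : Type*} [Fintype V] [DecidableEq V] (f : ℕ → ℕ → ℝ) (A : Finset V) :
    degreeSum f (bipartiteOf (A : Set V)) = #A * #Aᶜ * (f #A #Aᶜ + f #Aᶜ #A) := by
  have hin : ∀ u ∈ A, (bipartiteOf (A : Set V)).degree u = #Aᶜ := by
    intro u hu
    rw [← SimpleGraph.card_neighborFinset_eq_degree, SimpleGraph.neighborFinset_eq_filter]
    congr 1
    ext v
    simp [bipartiteOf, hu]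
  have hout : ∀ u ∈ Aᶜ, (bipartiteOf (A : Set V)).degree u = #A := by
    intro u hu
    rw [mem_compl] at hu
    rw [← SimpleGraph.card_neighborFinset_eq_degree, SimpleGraph.neighborFinset_eq_filter]
    congr 1
    ext v
    simp [bipartiteOf, hu]
  have h1 : ∀ u ∈ A, (∑ v, if (bipartiteOf (A : Set V)).Adj u v then
      f ((bipartiteOf (A : Set V)).degree u) ((bipartiteOf (A : Set V)).degree v) else 0) =
      #Aᶜ * f #Aᶜ #A := by
    intro u hu
    rw [← sum_add_sum_compl A, sum_eq_zero, zero_add, sum_congr rfl (g := fun _ => f #Aᶜ #A),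
      sum_const, nsmul_eq_mul]
    · intro v hv
      rw [hin u hu, hout v hv, if_pos]
      rw [mem_compl] at hv
      simp [bipartiteOf, hu, hv]
    · intro v hv
      simp [bipartiteOf, hu, hv]
  have h2 : ∀ u ∈ Aᶜ, (∑ v, if (bipartiteOf (A : Set V)).Adj u v then
      f ((bipartiteOf (A : Set V)).degree u) ((bipartiteOf (A : Set V)).degree v) else 0) =
      #A * f #A #Aᶜ := by
    intro u hu
    have hu' := mem_compl.1 hu
    rw [← sum_add_sum_compl A, add_comm, sum_eq_zero, zero_add,
      sum_congr rfl (g := fun _ => f #A #Aᶜ), sum_const, nsmul_eq_mul]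
    · intro v hv
      rw [hout u hu, hin v hv, if_pos]
      simp [bipartiteOf, hu', hv]
    · intro v hv
      rw [mem_compl] at hv
      simp [bipartiteOf, hu', hv]
  rw [degreeSum, ← sum_add_sum_compl A, sum_congr rfl h1, sum_congr rfl h2, sum_const, sum_const,
    nsmul_eq_mul, nsmul_eq_mul]
  ring

open Classical in
theorem free_bipartiteOf {W V : Type*} {F : SimpleGraph W} (hF : ¬ F.Colorable 2) (A : Set V) :
    F.Free (bipartiteOf A) := by
  rintro ⟨φ⟩
  apply hF
  have C : (bipartiteOf A).Coloring Prop := SimpleGraph.Coloring.mk (fun v => v ∈ A) (by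
    intro u v huv h
    simp only [bipartiteOf, eq_iff_iff] at huv h
    tauto)
  have : (bipartiteOf A).Colorable (Fintype.card Prop) := C.colorable
  rw [Fintype.card_prop] at this
  exact this.of_hom φ.toHom

theorem le_exIndex {W : Type*} {F : SimpleGraph W} (Q : GraphParameter) {n : ℕ}
    {G : SimpleGraph (Fin n)} (hG : F.Free G) : Q n G ≤ exIndex Q n F :=
  (isGreatest_exIndex Q n F ⟨G, hG⟩).2 ⟨G, hG, rfl⟩

-- This lets the extremal value itself play the role of `M` in the triangle-free bound.
open Finset in
theorem mul_le_exIndex {W : Type*} {F : SimpleGraph W} (hF : ¬ F.Colorable 2) (f : ℕ → ℕ → ℝ)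
    {a b n : ℕ} (hab : a + b = n) :
    a * b * (f a b + f b a) ≤ exIndex (fun _ G => degreeSum f G) n F := by
  obtain ⟨A, -, hA⟩ := exists_subset_card_eq (s := (univ : Finset (Fin n))) (n := a)
    (by rw [card_univ, Fintype.card_fin]; omega)
  have := le_exIndex (fun _ G => degreeSum f G) (free_bipartiteOf hF (A : Set (Fin n)))
  rwa [degreeSum_bipartiteOf, card_compl, Fintype.card_fin, hA, show n - a = b by omega] at this

/-- `f` is bounded and Lipschitz like a polynomial of degree `D`, with `f x x` of order `x ^ D`. -/
structure HasPolynomialGrowth (f : ℕ → ℕ → ℝ) (D : ℕ) : Prop where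
  le_pow : ∃ C : ℝ, 0 ≤ C ∧ ∀ n x y : ℕ, 1 ≤ x → 1 ≤ y → x ≤ n → y ≤ n → f x y ≤ C * n ^ D
  lipschitz : ∃ C : ℝ, 0 ≤ C ∧ ∀ n x y x' y' : ℕ, 1 ≤ x' → 1 ≤ y' → x' ≤ x → y' ≤ y → x ≤ n →
    y ≤ n → n * (f x y - f x' y') ≤ C * n ^ D * ((x - x') + (y - y'))
  pow_le : ∃ c : ℝ, 0 < c ∧ ∃ N : ℕ, ∀ x ≥ N, c * x ^ D ≤ f x x

/-- For nearly equal parts `a ≤ b`, monotonicity gives `f a b ≥ f a a`, so growth on the diagonal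
suffices. -/
theorem exists_pow_le_exIndex {W : Type*} {F : SimpleGraph W} (hF : ¬ F.Colorable 2)
    {f : ℕ → ℕ → ℝ} (hf : MonotoneInDegrees f) {D : ℕ} (hD : HasPolynomialGrowth f D) :
    ∃ c : ℝ, 0 < c ∧ ∃ N : ℕ, ∀ n ≥ N,
      c * n ^ (D + 2) ≤ exIndex (fun _ G => degreeSum f G) n F := by
  obtain ⟨c, hc, N, hN⟩ := hD.pow_le
  refine ⟨2 * c / 3 ^ (D + 2), by positivity, 2 * N + 2, fun n hn => ?_⟩
  obtain ⟨a, b, hab, ha, hb⟩ : ∃ a b : ℕ, a + b = n ∧ n ≤ 3 * a ∧ a ≤ b ∧ N ≤ a ∧ 1 ≤ a :=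
    ⟨n / 2, n - n / 2, by omega, by omega, by omega, by omega, by omega⟩
  obtain ⟨hb, haN, ha1⟩ := hb
  refine le_trans ?_ (mul_le_exIndex hF f hab)
  have h1 : c * (a : ℝ) ^ D ≤ f a b := (hN a haN).trans (hf _ _ _ _ ha1 ha1 le_rfl hb)
  have h2 : c * (a : ℝ) ^ D ≤ f b a := (hN a haN).trans (hf _ _ _ _ ha1 ha1 hb le_rfl)
  have ha' : (n : ℝ) / 3 ≤ a := by
    have : (n : ℝ) ≤ 3 * a := by exact_mod_cast ha
    linarith
  have hb' : (a : ℝ) ≤ b := by exact_mod_cast hb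
  have hpos : 0 ≤ c * (a : ℝ) ^ D := by positivity
  calc 2 * c / 3 ^ (D + 2) * (n : ℝ) ^ (D + 2) = 2 * c * ((n : ℝ) / 3) ^ (D + 2) := by
        rw [div_pow]
        ring
    _ ≤ 2 * c * (a : ℝ) ^ (D + 2) := by gcongr
    _ = a * a * (c * a ^ D + c * a ^ D) := by ring
    _ ≤ a * b * (f a b + f b a) := by gcongr

/-! ### Reduction to the triangle-free case -/

open Classical Finset in
theorem stability_of_hasPolynomialGrowth {W : Type*} [Finite W] {F : SimpleGraph W}
    (hF3 : F.Colorable 3) (hF2 : ¬ F.Colorable 2) {f : ℕ → ℕ → ℝ} (hf : MonotoneInDegrees f)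
    {D : ℕ} (hD : HasPolynomialGrowth f D) (ε : ℝ) (hε : 0 < ε) :
    ∃ δ : ℝ, 0 < δ ∧ ∃ n₀ : ℕ, ∀ n : ℕ, n₀ ≤ n → ∀ G : SimpleGraph (Fin n), F.Free G →
      (1 - δ) * exIndex (fun _ G => degreeSum f G) n F ≤ degreeSum f G →
        ∃ K : SimpleGraph (Fin n), IsCompleteBipartiteGraph K ∧
          (editDistance G K : ℝ) ≤ ε * (n : ℝ) ^ 2 := by
  obtain ⟨c, hc, N₁, hN₁⟩ := exists_pow_le_exIndex hF2 hf hD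
  obtain ⟨C₁, hC₁, hb⟩ := hD.le_pow
  obtain ⟨C₂, hC₂, hL⟩ := hD.lipschitz
  set C := max C₁ C₂ with hC
  have hC0 : 0 ≤ C := le_max_of_le_left hC₁
  -- Removal leaves deficiency `2 * δ`, hence distance `8 * δ * n ^ 2`, half of the budget; `1 / 4`
  -- ensures `2 * δ < 1`.
  set δ := min (ε / 16) (1 / 4) with hδ
  have hδ0 : 0 < δ := by positivity
  -- The second term keeps the loss `6 * C * η * n ^ (D + 2)` below `δ` times the extremal value;
  -- the `+ 1` covers `C = 0`.
  set η := min (ε / 2) (δ * c / (6 * C + 1)) with hη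
  have hη0 : 0 < η := by positivity
  obtain ⟨N₂, hN₂⟩ := card_cliqueFinset_three_lt_of_free hF3 (SimpleGraph.triangleRemovalBound η)
    (SimpleGraph.triangleRemovalBound_pos hη0)
  refine ⟨δ, hδ0, max (max N₁ N₂) 1, fun n hn G hG hQ => ?_⟩
  simp only [max_le_iff] at hn
  obtain ⟨⟨hn₁, hn₂⟩, hn0⟩ := hn
  have hn0' : (0 : ℝ) < n := by exact_mod_cast hn0
  have : Nonempty (Fin n) := ⟨⟨0, hn0⟩⟩
  obtain ⟨G', hle, hE, hfree⟩ : ∃ G' ≤ G,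
      (#G.edgeFinset - #G'.edgeFinset : ℝ) ≤ η * n ^ 2 ∧ G'.CliqueFree 3 := by
    obtain ⟨G', hle, _, hE, hfree⟩ := SimpleGraph.triangle_removal (G := G) (ε := η)
      (by rw [Fintype.card_fin]; exact hN₂ n hn₂ G hG)
    refine ⟨G', hle, ?_, hfree⟩
    rw [Fintype.card_fin] at hE
    push_cast at hE
    refine le_trans (le_of_eq ?_) hE.le
    congr!
  set M := exIndex (fun _ G => degreeSum f G) n F with hM
  have hMl := hN₁ n hn₁
  have hM0 : 0 < M := lt_of_lt_of_le (by positivity) hMl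
  have hpert := degreeSum_sub_degreeSum_le (f := f) (B := C * n ^ D) (by positivity)
    (fun x y hx hy hxn hyn => by
      rw [Fintype.card_fin] at hxn hyn
      refine (hb n x y hx hy hxn hyn).trans ?_
      gcongr
      exact le_max_left _ _)
    (fun x y x' y' hx hy hxx hyy hxn hyn => by
      rw [Fintype.card_fin] at hxn hyn ⊢
      refine (hL n x y x' y' hx hy hxx hyy hxn hyn).trans ?_
      have h1 : (x' : ℝ) ≤ x := by exact_mod_cast hxx
      have h2 : (y' : ℝ) ≤ y := by exact_mod_cast hyy
      have h3 : (0 : ℝ) ≤ (x - x') + (y - y') := by linarith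
      gcongr
      exact le_max_right _ _) hle
  have hη' : η * (6 * C + 1) ≤ δ * c := by
    rw [← le_div_iff₀ (by positivity)]
    exact min_le_right _ _
  have hloss : degreeSum f G - degreeSum f G' ≤ δ * M := by
    calc _ ≤ 6 * (C * n ^ D) * (η * n ^ 2) := hpert.trans (by gcongr)
      _ = (6 * C * η) * n ^ (D + 2) := by ring
      _ ≤ (δ * c) * n ^ (D + 2) := mul_le_mul_of_nonneg_right (by linarith) (by positivity)
      _ = δ * (c * n ^ (D + 2)) := by ring
      _ ≤ δ * M := by gcongr
  have hδ4 : δ ≤ 1 / 4 := min_le_right _ _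
  have hδε : δ ≤ ε / 16 := min_le_left _ _
  obtain ⟨K, hK, hKd⟩ := exists_editDistance_le_of_cliqueFree_three hf hM0 (δ := 2 * δ)
    (by linarith) (fun a b _ _ hab => by
      rw [Fintype.card_fin] at hab
      exact mul_le_exIndex hF2 f hab) hfree (by linarith)
  refine ⟨K, hK, ?_⟩
  rw [Fintype.card_fin] at hKd
  have h1 := editDistance_le_add hle K
  have h2 : η ≤ ε / 2 := min_le_left _ _
  calc (editDistance G K : ℝ) ≤ η * n ^ 2 + 4 * (2 * δ) * n ^ 2 := by linarith
    _ = (η + 8 * δ) * n ^ 2 := by ring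
    _ ≤ ε * n ^ 2 := mul_le_mul_of_nonneg_right (by linarith) (by positivity)

/-! ### Growth of monotone polynomials -/

open Finset in
theorem polyFun_eq_sum (p : MvPolynomial (Fin 2) ℝ) (x y : ℕ) :
    polyFun p x y = ∑ s ∈ p.support, p.coeff s * ((x : ℝ) ^ s 0 * (y : ℝ) ^ s 1) := by
  simp [polyFun, MvPolynomial.eval_eq', Fin.prod_univ_two]

theorem add_le_totalDegree {p : MvPolynomial (Fin 2) ℝ} {s : Fin 2 →₀ ℕ} (hs : s ∈ p.support) :
    s 0 + s 1 ≤ p.totalDegree := by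
  have := MvPolynomial.le_totalDegree hs
  rwa [Finsupp.sum_fintype _ _ (by simp), Fin.sum_univ_two] at this

open Finset in
theorem polyFun_le_mul_pow (p : MvPolynomial (Fin 2) ℝ) {n x y : ℕ} (hn : 1 ≤ n) (hx : x ≤ n)
    (hy : y ≤ n) :
    polyFun p x y ≤ (∑ s ∈ p.support, |p.coeff s|) * n ^ p.totalDegree := by
  rw [polyFun_eq_sum, sum_mul]
  refine sum_le_sum fun s hs => ?_
  have hx' : (x : ℝ) ≤ n := by exact_mod_cast hx
  have hy' : (y : ℝ) ≤ n := by exact_mod_cast hy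
  have hn' : (1 : ℝ) ≤ n := by exact_mod_cast hn
  calc p.coeff s * ((x : ℝ) ^ s 0 * (y : ℝ) ^ s 1)
      ≤ |p.coeff s| * ((n : ℝ) ^ s 0 * (n : ℝ) ^ s 1) := by
        gcongr
        exact le_abs_self _
    _ = |p.coeff s| * (n : ℝ) ^ (s 0 + s 1) := by rw [pow_add]
    _ ≤ _ := by
        gcongr
        exact add_le_totalDegree hs

/-- The mean value bound, multiplied by `n` so that the exponent `i - 1` does not appear. -/
theorem mul_pow_sub_pow_le {n x x' : ℝ} (hx' : 0 ≤ x') (hxx : x' ≤ x) (hx : x ≤ n) (i : ℕ) :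
    n * (x ^ i - x' ^ i) ≤ i * n ^ i * (x - x') := by
  have hn : 0 ≤ n := by linarith
  induction i with
  | zero => simp
  | succ i ih =>
    have h1 : n * (x ^ (i + 1) - x' ^ (i + 1)) =
        x * (n * (x ^ i - x' ^ i)) + n * x' ^ i * (x - x') := by ring
    have h2 : 0 ≤ n * (x ^ i - x' ^ i) :=
      mul_nonneg hn (sub_nonneg.2 (pow_le_pow_left₀ hx' hxx i))
    have h3 : x' ^ i ≤ n ^ i := pow_le_pow_left₀ hx' (hxx.trans hx) i
    have h4 : 0 ≤ x - x' := by linarith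
    calc _ ≤ n * (i * n ^ i * (x - x')) + n * n ^ i * (x - x') := by
          rw [h1]
          gcongr
      _ = _ := by push_cast; ring

theorem abs_mul_pow_mul_pow_sub_le {n x x' y y' : ℝ} (hx' : 0 ≤ x') (hxx : x' ≤ x) (hx : x ≤ n)
    (hy' : 0 ≤ y') (hyy : y' ≤ y) (hy : y ≤ n) (i j : ℕ) :
    |n * (x ^ i * y ^ j - x' ^ i * y' ^ j)| ≤
      (i + j : ℕ) * n ^ (i + j) * ((x - x') + (y - y')) := by
  have hn : 0 ≤ n := by linarith
  have h1 := mul_pow_sub_pow_le hx' hxx hx i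
  have h2 := mul_pow_sub_pow_le hy' hyy hy j
  have h3 : x ^ i ≤ n ^ i := pow_le_pow_left₀ (hx'.trans hxx) hx i
  have h4 : y' ^ j ≤ n ^ j := pow_le_pow_left₀ hy' (hyy.trans hy) j
  have h5 : 0 ≤ n * (x ^ i - x' ^ i) :=
    mul_nonneg hn (sub_nonneg.2 (pow_le_pow_left₀ hx' hxx i))
  have h6 : 0 ≤ n * (y ^ j - y' ^ j) :=
    mul_nonneg hn (sub_nonneg.2 (pow_le_pow_left₀ hy' hyy j))
  have hx0 : 0 ≤ x := hx'.trans hxx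
  have h7 : 0 ≤ x - x' := by linarith
  have h8 : 0 ≤ y - y' := by linarith
  have h9 : n * (x ^ i * y ^ j - x' ^ i * y' ^ j) =
      x ^ i * (n * (y ^ j - y' ^ j)) + (n * (x ^ i - x' ^ i)) * y' ^ j := by ring
  rw [h9, abs_of_nonneg (by positivity)]
  calc _ ≤ n ^ i * (j * n ^ j * (y - y')) + (i * n ^ i * (x - x')) * n ^ j := by gcongr
    _ = n ^ (i + j) * (j * (y - y') + i * (x - x')) := by ring
    _ ≤ n ^ (i + j) * ((i + j : ℕ) * (y - y') + (i + j : ℕ) * (x - x')) := by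
        gcongr <;> omega
    _ = _ := by ring

open Finset in
theorem mul_polyFun_sub_le (p : MvPolynomial (Fin 2) ℝ) {n x y x' y' : ℕ} (hn : 1 ≤ n)
    (hxx : x' ≤ x) (hyy : y' ≤ y) (hx : x ≤ n) (hy : y ≤ n) :
    n * (polyFun p x y - polyFun p x' y') ≤
      (∑ s ∈ p.support, |p.coeff s| * p.totalDegree) * n ^ p.totalDegree *
        ((x - x') + (y - y')) := by
  rw [polyFun_eq_sum, polyFun_eq_sum, ← sum_sub_distrib, mul_sum, sum_mul, sum_mul]
  refine sum_le_sum fun s hs => ?_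
  have h1 : (x' : ℝ) ≤ x := by exact_mod_cast hxx
  have h2 : (y' : ℝ) ≤ y := by exact_mod_cast hyy
  have h3 : (x : ℝ) ≤ n := by exact_mod_cast hx
  have h4 : (y : ℝ) ≤ n := by exact_mod_cast hy
  have hn' : (1 : ℝ) ≤ n := by exact_mod_cast hn
  have h5 : (0 : ℝ) ≤ (x - x') + (y - y') := by linarith
  have h6 := add_le_totalDegree hs
  calc _ = p.coeff s * (n * ((x : ℝ) ^ s 0 * (y : ℝ) ^ s 1 - (x' : ℝ) ^ s 0 * (y' : ℝ) ^ s 1)) := by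
        ring
    _ ≤ |p.coeff s| * |n * ((x : ℝ) ^ s 0 * (y : ℝ) ^ s 1 - (x' : ℝ) ^ s 0 * (y' : ℝ) ^ s 1)| := by
        rw [← abs_mul]
        exact le_abs_self _
    _ ≤ |p.coeff s| * ((s 0 + s 1 : ℕ) * n ^ (s 0 + s 1) * ((x - x') + (y - y'))) := by
        gcongr
        exact abs_mul_pow_mul_pow_sub_le (by positivity) h1 h3 (by positivity) h2 h4 _ _
    _ ≤ |p.coeff s| * (p.totalDegree * n ^ p.totalDegree * ((x - x') + (y - y'))) := by
        gcongr
    _ = _ := by ring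

open Finset Filter Topology in
/-- Along a ray, a polynomial grows like its homogeneous component of top degree. -/
theorem tendsto_polyFun_div_pow (p : MvPolynomial (Fin 2) ℝ) (a b : ℕ) :
    Tendsto (fun t : ℕ => polyFun p (a * t) (b * t) / (t : ℝ) ^ p.totalDegree) atTop
      (𝓝 (MvPolynomial.eval ![(a : ℝ), (b : ℝ)]
        (MvPolynomial.homogeneousComponent p.totalDegree p))) := by
  have h1 : MvPolynomial.eval ![(a : ℝ), (b : ℝ)]
      (MvPolynomial.homogeneousComponent p.totalDegree p) = ∑ s ∈ p.support,
        if s 0 + s 1 = p.totalDegree then p.coeff s * ((a : ℝ) ^ s 0 * (b : ℝ) ^ s 1) else 0 := by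
    rw [MvPolynomial.homogeneousComponent_apply, map_sum, sum_filter]
    refine sum_congr rfl fun s _ => ?_
    rw [Finsupp.degree_eq_sum, Fin.sum_univ_two, MvPolynomial.eval_monomial,
      Finsupp.prod_fintype _ _ (by simp), Fin.prod_univ_two]
    rfl
  rw [h1]
  simp only [polyFun_eq_sum, sum_div]
  refine tendsto_finsetSum _ fun s hs => ?_
  have h2 := add_le_totalDegree hs
  have h3 : ∀ t : ℕ, p.coeff s * (((a * t : ℕ) : ℝ) ^ s 0 * ((b * t : ℕ) : ℝ) ^ s 1) /
      (t : ℝ) ^ p.totalDegree = p.coeff s * ((a : ℝ) ^ s 0 * (b : ℝ) ^ s 1) *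
        ((t : ℝ) ^ (s 0 + s 1) / (t : ℝ) ^ p.totalDegree) := by
    intro t
    push_cast
    ring
  simp only [h3]
  split_ifs with h
  · nth_rewrite 2 [← mul_one (p.coeff s * ((a : ℝ) ^ s 0 * (b : ℝ) ^ s 1))]
    refine Tendsto.const_mul _ ?_
    rw [h]
    refine tendsto_const_nhds.congr' ?_
    filter_upwards [eventually_gt_atTop 0] with t ht
    have : (t : ℝ) ≠ 0 := by positivity
    field_simp
  · rw [← mul_zero (p.coeff s * ((a : ℝ) ^ s 0 * (b : ℝ) ^ s 1))]
    refine Tendsto.const_mul _ ?_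
    exact (tendsto_pow_div_pow_atTop_zero (𝕜 := ℝ) (lt_of_le_of_ne h2 h)).comp
      tendsto_natCast_atTop_atTop

theorem homogeneousComponent_totalDegree_ne_zero {σ R : Type*} [CommSemiring R]
    {p : MvPolynomial σ R} (hp : p ≠ 0) :
    MvPolynomial.homogeneousComponent p.totalDegree p ≠ 0 := by
  obtain ⟨s, hs, hsd⟩ := Finset.exists_mem_eq_sup p.support (MvPolynomial.support_nonempty.2 hp)
    fun s => s.sum fun _ e => e
  intro h
  have h1 := congrArg (MvPolynomial.coeff s) h
  rw [MvPolynomial.coeff_homogeneousComponent, if_pos] at h1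
  · exact MvPolynomial.mem_support_iff.1 hs (by simpa using h1)
  · exact hsd.symm

open Filter Topology in
/-- The top degree component of a monotone polynomial of positive degree is positive at `(1, 1)`. -/
theorem eval_homogeneousComponent_pos {p : MvPolynomial (Fin 2) ℝ}
    (hp : MonotoneInDegrees (polyFun p)) (hd : 0 < p.totalDegree) :
    0 < MvPolynomial.eval ![((1 : ℕ) : ℝ), ((1 : ℕ) : ℝ)]
      (MvPolynomial.homogeneousComponent p.totalDegree p) := by
  have hp0 : p ≠ 0 := by
    rintro rfl
    simp at hd
  set D := p.totalDegree with hD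
  set h := MvPolynomial.homogeneousComponent D p with hh
  -- On a ray the polynomial stays above its value at `(1, 1)`, which is negligible against `t ^ D`
  -- since `D > 0`.
  have hnonneg : ∀ a b : ℕ, 1 ≤ a → 1 ≤ b → 0 ≤ MvPolynomial.eval ![(a : ℝ), (b : ℝ)] h := by
    intro a b ha hb
    have h1 : Tendsto (fun t : ℕ => polyFun p 1 1 / (t : ℝ) ^ D) atTop (𝓝 0) :=
      tendsto_const_nhds.div_atTop
        ((tendsto_pow_atTop hd.ne').comp tendsto_natCast_atTop_atTop)
    refine le_of_tendsto_of_tendsto h1 (tendsto_polyFun_div_pow p a b) ?_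
    filter_upwards [eventually_ge_atTop 1] with t ht
    gcongr
    exact hp _ _ _ _ le_rfl le_rfl (Nat.mul_pos ha ht) (Nat.mul_pos hb ht)
  -- If `h` vanished at `(1, 1)`, the diagonal value at `(a + b) * t`, which dominates the value at
  -- `(a * t, b * t)`, would be `o(t ^ D)`. Then `h` would vanish at all positive integer points,
  -- hence identically.
  refine lt_of_le_of_ne (hnonneg 1 1 le_rfl le_rfl) fun h0 => ?_
  apply homogeneousComponent_totalDegree_ne_zero hp0
  refine MvPolynomial.funext_set (fun _ => (fun m : ℕ => (m : ℝ)) '' Set.Ici 1)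
    (fun _ => (Set.Ici_infinite 1).image Nat.cast_injective.injOn) fun x hx => ?_
  rw [map_zero]
  obtain ⟨a, ha, hxa⟩ := hx 0 trivial
  obtain ⟨b, hb, hxb⟩ := hx 1 trivial
  have hx2 : x = ![(a : ℝ), (b : ℝ)] := by
    funext i
    fin_cases i
    · exact hxa.symm
    · exact hxb.symm
  rw [hx2]
  rw [Set.mem_Ici] at ha hb
  refine le_antisymm ?_ (hnonneg a b ha hb)
  have h1 : Tendsto (fun t : ℕ => ((a + b : ℕ) : ℝ) ^ D *
      (polyFun p (1 * ((a + b) * t)) (1 * ((a + b) * t)) / (((a + b) * t : ℕ) : ℝ) ^ D)) atTop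
      (𝓝 (((a + b : ℕ) : ℝ) ^ D * 0)) := by
    refine Tendsto.const_mul _ ?_
    rw [h0]
    exact (tendsto_polyFun_div_pow p 1 1).comp
      (tendsto_id.const_mul_atTop' (show 0 < a + b by omega))
  rw [mul_zero] at h1
  refine le_of_tendsto_of_tendsto (tendsto_polyFun_div_pow p a b) h1 ?_
  filter_upwards [eventually_ge_atTop 1] with t ht
  have ht0 : (0 : ℝ) < t := by exact_mod_cast ht
  have hab0 : (0 : ℝ) < ((a + b : ℕ) : ℝ) := by
    have : 0 < a + b := by omega
    exact_mod_cast this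
  rw [Nat.cast_mul, mul_pow, ← mul_div_assoc, mul_div_mul_left _ _ (by positivity)]
  gcongr
  refine hp _ _ _ _ (Nat.mul_pos ha ht) (Nat.mul_pos hb ht) ?_ ?_ <;> nlinarith

open Filter Topology in
/-- A nonzero monotone polynomial grows like a power, unless it is a negative constant. -/
theorem hasPolynomialGrowth_or_neg_const {p : MvPolynomial (Fin 2) ℝ} (hp0 : p ≠ 0)
    (hp : MonotoneInDegrees (polyFun p)) :
    HasPolynomialGrowth (polyFun p) p.totalDegree ∨ ∃ c < 0, ∀ x y, polyFun p x y = c := by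
  have key : (∃ c : ℝ, 0 < c ∧ ∃ N : ℕ, ∀ x ≥ N, c * x ^ p.totalDegree ≤ polyFun p x x) →
      HasPolynomialGrowth (polyFun p) p.totalDegree := fun h =>
    { le_pow := ⟨_, Finset.sum_nonneg fun _ _ => abs_nonneg _, fun n x y hx _ hxn hyn =>
        polyFun_le_mul_pow p (hx.trans hxn) hxn hyn⟩
      lipschitz := ⟨_, Finset.sum_nonneg fun _ _ => by positivity,
        fun n x y x' y' hx _ hxx hyy hxn hyn =>
          mul_polyFun_sub_le p (hx.trans (hxx.trans hxn)) hxx hyy hxn hyn⟩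
      pow_le := h }
  rcases Nat.eq_zero_or_pos p.totalDegree with hd | hd
  · have hC := MvPolynomial.totalDegree_eq_zero_iff_eq_C.1 hd
    have hval : ∀ x y, polyFun p x y = p.coeff 0 := by
      intro x y
      rw [polyFun, hC]
      simp
    rcases lt_trichotomy (p.coeff 0) 0 with h | h | h
    · exact Or.inr ⟨_, h, hval⟩
    · rw [h, map_zero] at hC
      exact absurd hC hp0
    · refine Or.inl (key ⟨p.coeff 0, h, 0, fun x _ => ?_⟩)
      simp [hval, hd]
  · refine Or.inl (key ?_)
    have hpos := eval_homogeneousComponent_pos hp hd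
    have hlim := tendsto_polyFun_div_pow p 1 1
    refine ⟨_, half_pos hpos, ?_⟩
    obtain ⟨N, hN⟩ := eventually_atTop.1
      ((hlim.eventually_const_le (half_lt_self hpos)).and (eventually_gt_atTop 0))
    refine ⟨N, fun x hx => ?_⟩
    obtain ⟨h1, h2⟩ := hN x hx
    rwa [one_mul, le_div_iff₀ (by positivity)] at h1

/-! ### Negative constants and the conclusion -/

open Classical Finset in
theorem degreeSum_const {V : Type*} [Fintype V] (c : ℝ) (G : SimpleGraph V) :
    degreeSum (fun _ _ => c) G = 2 * #G.edgeFinset * c := by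
  have h : degreeSum (fun _ _ => c) G = ∑ u : V, G.degree u * c :=
    sum_sum_ite_adj G fun _ => c
  rw [h, ← sum_mul, ← Nat.cast_sum, G.sum_degrees_eq_twice_card_edges]
  push_cast
  ring

open Classical Finset in
/-- For a negative constant the only near-extremal graphs are empty, and a star has few edges. -/
theorem stability_of_neg_const {W : Type*} {F : SimpleGraph W} (hF2 : ¬ F.Colorable 2) {c : ℝ}
    (hc : c < 0) (ε : ℝ) (hε : 0 < ε) :
    ∃ δ : ℝ, 0 < δ ∧ ∃ n₀ : ℕ, ∀ n : ℕ, n₀ ≤ n → ∀ G : SimpleGraph (Fin n), F.Free G →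
      (1 - δ) * exIndex (fun _ G => degreeSum (fun _ _ => c) G) n F ≤ degreeSum (fun _ _ => c) G →
        ∃ K : SimpleGraph (Fin n), IsCompleteBipartiteGraph K ∧
          (editDistance G K : ℝ) ≤ ε * (n : ℝ) ^ 2 := by
  obtain ⟨N, hN⟩ := exists_nat_gt (2 / ε)
  -- The empty graph makes the extremal value nonnegative, so `δ = 1 / 2` already forces a
  -- nonnegative index, hence no edges. With `n ≥ 2` both parts of the star are nonempty.
  refine ⟨1 / 2, by norm_num, max N 2, fun n hn G _ hQ => ?_⟩
  simp only [max_le_iff] at hn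
  obtain ⟨hnN, hn2⟩ := hn
  have hfree : F.Free (⊥ : SimpleGraph (Fin n)) := by
    have : bipartiteOf (∅ : Set (Fin n)) = ⊥ := by
      ext u v
      simp [bipartiteOf]
    rw [← this]
    exact free_bipartiteOf hF2 _
  have h0 : 0 ≤ exIndex (fun _ G => degreeSum (fun _ _ => c) G) n F := by
    simpa [degreeSum] using le_exIndex (fun _ G => degreeSum (fun _ _ => c) G) hfree
  have hE : #G.edgeFinset = 0 := by
    by_contra hne
    have : (0 : ℝ) < #G.edgeFinset := by exact_mod_cast Nat.pos_of_ne_zero hne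
    have : 2 * (#G.edgeFinset : ℝ) * c < 0 := mul_neg_of_pos_of_neg (by positivity) hc
    rw [degreeSum_const c G] at hQ
    linarith
  have hG : ∀ u v, ¬ G.Adj u v := by
    intro u v huv
    have : s(u, v) ∈ G.edgeFinset := by simpa using huv
    rw [card_eq_zero] at hE
    simp [hE] at this
  set v₀ : Fin n := ⟨0, by omega⟩
  have hd := editDistance_bipartiteOf_le (G := G) (A := {v₀}) (fun u _ v _ => hG u v) (fun v => by
    have : G.degree v = 0 := by
      rw [← G.card_neighborFinset_eq_degree, card_eq_zero, G.neighborFinset_eq_filter]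
      simp [hG]
    omega)
  refine ⟨_, ⟨(({v₀} : Finset (Fin n)) : Set (Fin n)), ⟨v₀, by simp⟩,
    ⟨⟨1, by omega⟩, by simp [v₀, Fin.ext_iff]⟩, fun _ _ => Iff.rfl⟩, hd.trans ?_⟩
  have hn0 : (0 : ℝ) < n := by
    have : 0 < n := by omega
    exact_mod_cast this
  have hnε : 2 ≤ ε * n := by
    have h1 : (N : ℝ) ≤ n := by exact_mod_cast hnN
    have h2 : 2 / ε ≤ n := by linarith
    rw [div_le_iff₀ hε] at h2
    linarith
  rw [sum_singleton, Fintype.card_fin, card_singleton]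
  have h3 : (0 : ℝ) ≤ G.degree v₀ := by positivity
  calc 2 * ((n : ℝ) - (1 : ℕ) - G.degree v₀) ≤ 2 * n := by push_cast; linarith
    _ ≤ (ε * n) * n := by gcongr
    _ = ε * n ^ 2 := by ring

theorem mainTheorem7 (Q : GraphParameter) (hQ : IsMonotonePolynomialIndex Q)
    (hQ0 : ∃ (n : ℕ) (G : SimpleGraph (Fin n)), Q n G ≠ 0)
    {W : Type*} [Finite W] (F : SimpleGraph W) (hF : F.chromaticNumber = 3)
    (ε : ℝ) (hε : 0 < ε) :
    ∃ δ : ℝ, 0 < δ ∧ ∃ n₀ : ℕ, ∀ n : ℕ, n₀ ≤ n →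
      ∀ G : SimpleGraph (Fin n), F.Free G →
        (1 - δ) * exIndex Q n F ≤ Q n G →
          ∃ K : SimpleGraph (Fin n), IsCompleteBipartiteGraph K ∧
            (editDistance G K : ℝ) ≤ ε * (n : ℝ) ^ 2 := by
  obtain ⟨p, hp, hQp⟩ := hQ
  obtain rfl : Q = fun _ G => degreeSum (polyFun p) G := by
    funext n G
    exact hQp n G
  have hp0 : p ≠ 0 := by
    rintro rfl
    obtain ⟨n, G, hne⟩ := hQ0
    exact hne (by simp [degreeSum, polyFun])
  have hF3 : F.Colorable 3 := SimpleGraph.chromaticNumber_le_iff_colorable.1 hF.le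
  have hF2 : ¬ F.Colorable 2 := fun h => by
    have := SimpleGraph.chromaticNumber_le_iff_colorable.2 h
    rw [hF] at this
    exact absurd this (by decide)
  rcases hasPolynomialGrowth_or_neg_const hp0 hp with hD | ⟨c, hc, hconst⟩
  · exact stability_of_hasPolynomialGrowth hF3 hF2 hp hD ε hε
  · rw [show polyFun p = fun _ _ => c from funext₂ hconst]
    exact stability_of_neg_const hF2 hc ε hε
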